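/- Let $\Lambda$ be a left and right noetherian ring. Let $0\to\Lambda\to I_0\to I_1\to\cdots$ be a minimal injective resolution of $\Lambda$ as a right $\Lambda$-module and $0\to\Lambda\to I'_0\to I'_1\to\cdots$ a minimal injective resolution of $\Lambda$ as a left $\Lambda$-module. Let $\mathrm{l.fd}$ and $\mathrm{r.fd}$ denote the flat dimension of left, respectively right, $\Lambda$-modules; the zero module, and no other, has flat dimension $\le -1$. A finitely generated right $\Lambda$-module $N$ has grade $k$ (an integer $k\ge 0$) if $\mathrm{Ext}^i_\Lambda(N,\Lambda)=0$ for all $0\le i<k$ and $\mathrm{Ext}^k_\Lambda(N,\Lambda)\ne 0$; it is pure of grade $k$ if $N\neq 0$ and every non-zero submodule of $N$ has grade $k$. Let $k\ge 0$ be an integer and let $N$ be a finitely generated right $\Lambda$-module of grade $k$. (1) If $\mathrm{l.fd}_\Lambda\bigl(\bigoplus_{i=0}^{k} I'_i\bigr)\le k$ and $N$ is pure of grade $k$, then $N$ can be embedded into a finite direct sum of copies of $I_k$. (2) If $\mathrm{r.fd}_\Lambda\bigl(\bigoplus_{i=0}^{k-1} I_i\bigr)\le k-1$ (a condition that holds trivially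 for $k=0$, where the sum is empty), $\mathrm{r.fd}_\Lambda I_k\le k$, and $N$ can be embedded into a finite direct sum of copies of $I_k$, then $N$ is pure of grade $k$. -/

import Mathlib

universe u

open CategoryTheory
open scoped TensorProduct DirectSum

/-! Left modules over a ring `R` are `Module R M`; right modules are `Module Rᵐᵒᵖ A`,
with `a r` written `MulOpposite.op r • a`. -/

namespace PureModules

section Tensor

variable (R : Type*) [Ring R]

/-- The subgroup of `A ⊗_ℤ M` generated by all `a r ⊗ m - a ⊗ r m`. -/
def balancedRel (A M : Type*) [AddCommGroup A] [Module Rᵐᵒᵖ A] [AddCommGroup M] [Module R M] :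
    AddSubgroup (A ⊗[ℤ] M) :=
  AddSubgroup.closure
    {t | ∃ (a : A) (r : R) (m : M), t = (MulOpposite.op r • a) ⊗ₜ[ℤ] m - a ⊗ₜ[ℤ] (r • m)}

/-- The tensor product `A ⊗_R M` (an abelian group) of a right module `A` and a left module `M`
over a not necessarily commutative ring `R`. -/
abbrev RTensor (A M : Type*) [AddCommGroup A] [Module Rᵐᵒᵖ A] [AddCommGroup M] [Module R M] :
    Type _ :=
  (A ⊗[ℤ] M) ⧸ balancedRel R A M

/-- The homomorphism `f ⊗ g : A ⊗_R M → B ⊗_R L`. -/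
def RTensor.map {A B M L : Type*} [AddCommGroup A] [Module Rᵐᵒᵖ A] [AddCommGroup B]
    [Module Rᵐᵒᵖ B] [AddCommGroup M] [Module R M] [AddCommGroup L] [Module R L]
    (f : A →ₗ[Rᵐᵒᵖ] B) (g : M →ₗ[R] L) : RTensor R A M →+ RTensor R B L :=
  QuotientAddGroup.map (balancedRel R A M) (balancedRel R B L)
    (TensorProduct.map f.toAddMonoidHom.toIntLinearMap
      g.toAddMonoidHom.toIntLinearMap).toAddMonoidHom <| by
      refine (AddSubgroup.closure_le _).2 ?_
      rintro _ ⟨a, r, m, rfl⟩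
      refine AddSubgroup.subset_closure ⟨f a, r, g m, ?_⟩
      simp

end Tensor

section Flat

variable (R : Type u) [Ring R]

/-- A left `R`-module `M` is flat if `- ⊗_R M` preserves injectivity of homomorphisms of
right `R`-modules. -/
def LeftFlat (M : Type u) [AddCommGroup M] [Module R M] : Prop :=
  ∀ (A B : Type u) [AddCommGroup A] [Module Rᵐᵒᵖ A] [AddCommGroup B] [Module Rᵐᵒᵖ B]
    (f : A →ₗ[Rᵐᵒᵖ] B), Function.Injective f →
      Function.Injective (RTensor.map R f (LinearMap.id : M →ₗ[R] M))

/-- A right `R`-module `A` is flat if `A ⊗_R -` preserves injectivity of homomorphisms of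
left `R`-modules. -/
def RightFlat (A : Type u) [AddCommGroup A] [Module Rᵐᵒᵖ A] : Prop :=
  ∀ (M L : Type u) [AddCommGroup M] [Module R M] [AddCommGroup L] [Module R L]
    (g : M →ₗ[R] L), Function.Injective g →
      Function.Injective (RTensor.map R (LinearMap.id : A →ₗ[Rᵐᵒᵖ] A) g)

/-- `HasResolutionLT P n M`: there is an exact sequence `0 → F_{n-1} → ⋯ → F_0 → M → 0` of
modules with every `F_i` satisfying `P`; for `n = 0` this says that `M` is zero. -/
def HasResolutionLT {S : Type u} [Ring S] (P : ModuleCat.{u} S → Prop) :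
    ℕ → ModuleCat.{u} S → Prop
  | 0, M => Subsingleton M
  | n + 1, M => ∃ (F : ModuleCat.{u} S) (f : F →ₗ[S] M), P F ∧ Function.Surjective f ∧
      HasResolutionLT P n (ModuleCat.of S (LinearMap.ker f))

/-- The left flat dimension of the left `R`-module `M` is `< n`, that is, `≤ n - 1`, where
the zero module is the only one of flat dimension `≤ -1`. -/
def LeftFlatDimLT (M : Type u) [AddCommGroup M] [Module R M] (n : ℕ) : Prop :=
  HasResolutionLT (fun F : ModuleCat.{u} R => LeftFlat R F) n (ModuleCat.of R M)

/-- The right flat dimension of the right `R`-module `A` is `< n`, that is, `≤ n - 1`, where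
the zero module is the only one of flat dimension `≤ -1`. -/
def RightFlatDimLT (A : Type u) [AddCommGroup A] [Module Rᵐᵒᵖ A] (n : ℕ) : Prop :=
  HasResolutionLT (fun F : ModuleCat.{u} Rᵐᵒᵖ => RightFlat R F) n (ModuleCat.of Rᵐᵒᵖ A)

/-- `l.fd M ≤ n`. -/
def LeftFlatDimLE (M : Type u) [AddCommGroup M] [Module R M] (n : ℕ) : Prop :=
  LeftFlatDimLT R M (n + 1)

/-- `r.fd A ≤ n`. -/
def RightFlatDimLE (A : Type u) [AddCommGroup A] [Module Rᵐᵒᵖ A] (n : ℕ) : Prop :=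
  RightFlatDimLT R A (n + 1)

end Flat

/-- An injective resolution `0 → M → I_0 → I_1 → ⋯` of a module is minimal if each `I_i` is an
essential extension (hence an injective envelope) of `Ker (I_i → I_{i+1})`. For `i = 0` this
kernel is the image of `M`, and for `i > 0` it is the image of `I_{i-1}`. -/
def IsMinimal {S : Type u} [Ring S] {M : ModuleCat.{u} S} (I : InjectiveResolution M) : Prop :=
  ∀ (i : ℕ) (U : Submodule S (I.cocomplex.X i)),
    U ⊓ LinearMap.ker (I.cocomplex.d i (i + 1)).hom = ⊥ → U = ⊥

section Grade

variable (R : Type u) [Ring R]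

/-- The right `R`-module `N` has grade `k`: `Ext_R^i(N, R) = 0` for `0 ≤ i < k` and
`Ext_R^k(N, R) ≠ 0`, where `R` is regarded as a right module over itself. -/
def HasGrade (N : Type u) [AddCommGroup N] [Module Rᵐᵒᵖ N] (k : ℕ) : Prop :=
  (∀ i < k, Subsingleton (Abelian.Ext (ModuleCat.of Rᵐᵒᵖ N) (ModuleCat.of Rᵐᵒᵖ R) i)) ∧
    Nontrivial (Abelian.Ext (ModuleCat.of Rᵐᵒᵖ N) (ModuleCat.of Rᵐᵒᵖ R) k)

/-- The right `R`-module `N` is pure of grade `k`: it is non-zero and each of its non-zero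
submodules has grade `k`. -/
def IsPureOfGrade (N : Type u) [AddCommGroup N] [Module Rᵐᵒᵖ N] (k : ℕ) : Prop :=
  Nontrivial N ∧ ∀ A : Submodule Rᵐᵒᵖ N, A ≠ ⊥ → HasGrade R A k

end Grade

/-- The `S`-module `N` embeds in a finite direct sum `E^n` of copies of `E`. -/
def EmbedsInFiniteCopies (S : Type*) [Ring S] (N E : Type*) [AddCommGroup N] [Module S N]
    [AddCommGroup E] [Module S E] : Prop :=
  ∃ (n : ℕ) (f : N →ₗ[S] (Fin n → E)), Function.Injective f

end PureModules

/-! (1) Represent generators of the left module Ext^k(N,Λ) by maps N → I_k and let A be their common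
kernel. All of Ext^k(N,Λ) restricts to zero on A, so T = Ext^k(A,Λ) embeds in Ext^{k+1}(N/A,Λ). For
an injective left module E, Hom(Ext^{k+1}(N/A,Λ),E) = Tor_{k+1}(N/A,E), and this vanishes for E =
I'_i, i ≤ k, by the flat dimension bound. Hence Hom(T,I'_i) = 0 and Ext^m(T,Λ) = 0 for m ≤ k. If A ≠
0, purity gives A grade k; dualizing a free resolution of A then embeds T in a module with a free
resolution of length k, which forces T = 0 (`subsingleton_ext_of_forall_ext_ext`), a contradiction.

(2) If Ext^i(X,Λ) = 0 for i < m and r.fd E < m, the dual of a free resolution of X stays exact at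
its first place after tensoring with E, that is, Hom(X,E) = 0
(`linearMap_eq_zero_of_rightFlatDimLT`). For X = N, m = k this gives Hom(N,I_i) = 0 for i < k, hence
Hom(A,I_i) = 0 and Ext^i(A,Λ) = 0 for each submodule A. If Ext^k(A,Λ) vanished too, then X = A, m =
k + 1 would give Hom(A,I_k) = 0, impossible for a nonzero A inside copies of I_k.

Tor is never formed: resolutions are sequences of matrices, tensoring with E means acting on columns
over E, and flat dimension enters through `colMap_exact_of_hasResolutionLT`. -/

namespace PureModules

/-! ### Matrices acting on columns over a module. -/

section MatrixAction

variable {S : Type*} [Ring S] {E : Type*} [AddCommGroup E] [Module S E]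
variable {m n l : Type*} [Fintype n]

/-- The action of an `m × n` matrix over `S` on columns with entries in an `S`-module. -/
def colMap (E : Type*) [AddCommGroup E] [Module S E] (M : Matrix m n S) : (n → E) →+ (m → E) where
  toFun e i := ∑ j, M i j • e j
  map_zero' := by ext; simp
  map_add' x y := by ext; simp [Finset.sum_add_distrib]

lemma colMap_apply (M : Matrix m n S) (e : n → E) (i : m) :
    colMap E M e i = ∑ j, M i j • e j := rfl

lemma colMap_comp_linearMap {F : Type*} [AddCommGroup F] [Module S F] (f : E →ₗ[S] F)
    (M : Matrix m n S) (e : n → E) :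
    colMap F M (fun j => f (e j)) = fun i => f (colMap E M e i) := by
  ext i; simp [colMap_apply, map_sum]

lemma colMap_colMap [Fintype m] (M : Matrix m n S) (N : Matrix l m S) (e : n → E) :
    colMap E N (colMap E M e) = colMap E (N * M) e := by
  ext i
  simp only [colMap_apply, Finset.smul_sum, Matrix.mul_apply, Finset.sum_smul, mul_smul]
  exact Finset.sum_comm

lemma mul_eq_zero_of_colMap_exact [Fintype m] [DecidableEq n] {M : Matrix m n S} {N : Matrix l m S}
    (h : Function.Exact (colMap S M) (colMap S N)) : N * M = 0 := by
  ext i j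
  have := congrFun (h.apply_apply_eq_zero (Pi.single j 1)) i
  rw [colMap_colMap] at this
  simpa [colMap_apply, Pi.single_apply] using this

end MatrixAction

/-- The property of a module that tensoring with it preserves the exactness of sequences
of finitely generated free modules. -/
def PreservesColExact (S : Type*) [Ring S] (F : Type*) [AddCommGroup F] [Module S F] : Prop :=
  ∀ ⦃a b c : ℕ⦄ (M : Matrix (Fin b) (Fin a) S) (N : Matrix (Fin c) (Fin b) S),
    Function.Exact (colMap S M) (colMap S N) → Function.Exact (colMap F M) (colMap F N)

/-! ### Flat modules preserve exactness of matrix sequences. -/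

section Flat

variable (R : Type u) [Ring R]

lemma RTensor.hom_ext_zero {A M : Type*} [AddCommGroup A] [Module Rᵐᵒᵖ A] [AddCommGroup M]
    [Module R M] (Q : Type*) [AddCommGroup Q] (β : A →+ M →+ Q)
    (hβ : ∀ a (r : R) m, β (MulOpposite.op r • a) m = β a (r • m)) {ι : Type*} [Fintype ι]
    (x : ι → A) (y : ι → M)
    (h : (QuotientAddGroup.mk (∑ i, x i ⊗ₜ[ℤ] y i) : RTensor R A M) = 0) :
    ∑ i, β (x i) (y i) = 0 := by
  let L : A ⊗[ℤ] M →+ Q := TensorProduct.liftAddHom β (by intro z a m; simp)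
  have hL : balancedRel R A M ≤ L.ker := by
    refine (AddSubgroup.closure_le _).2 ?_
    rintro _ ⟨a, r, m, rfl⟩
    simp [L, AddMonoidHom.mem_ker, hβ]
  have := hL ((QuotientAddGroup.eq_zero_iff _).1 h)
  simpa [L, AddMonoidHom.mem_ker, map_sum] using this

/-- Let C ⊆ R^c be the image of `N`. If `N` kills the column e, then ∑ N(ε_j) ⊗ e_j vanishes in R^c
⊗ F, hence in C ⊗ F by flatness. The pairing (N x, f) ↦ [(x_j f)_j] into F^b / im `M` is well
defined because ker `N` = im `M`, and it is balanced; it sends that tensor to the class of e, so e ∈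
im `M`. -/
lemma LeftFlat.preservesColExact {F : Type u} [AddCommGroup F] [Module R F]
    (hF : LeftFlat R F) : PreservesColExact R F := by
  intro a b c M N hMN
  classical
  have hNM := mul_eq_zero_of_colMap_exact hMN
  intro e
  refine ⟨fun he => ?_, ?_⟩
  swap
  · rintro ⟨f, rfl⟩
    rw [colMap_colMap, hNM]; ext; simp [colMap_apply]
  let φ : (Fin b → R) →ₗ[Rᵐᵒᵖ] (Fin c → R) :=
    { colMap R N with
      map_smul' := by
        intro r x; ext i
        simp [colMap_apply, Finset.sum_mul, mul_assoc] }
  have hφ : ∀ x, φ x = colMap R N x := fun _ => rfl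
  let C := LinearMap.range φ
  let Q := (Fin b → F) ⧸ (colMap F M).range
  let γ : (Fin b → R) →+ (F →+ Q) :=
    { toFun := fun x => (QuotientAddGroup.mk' (colMap F M).range).comp
        { toFun := fun f j => x j • f
          map_zero' := by ext; simp
          map_add' := by intros; ext; simp }
      map_zero' := by
        ext f
        refine (congrArg QuotientAddGroup.mk ?_).trans (QuotientAddGroup.mk_zero _)
        ext; simp
      map_add' := by
        intro x y; ext f
        simp only [AddMonoidHom.comp_apply, AddMonoidHom.add_apply]
        rw [← map_add]; congr 1; ext; simp [add_smul] }
  have hγ : ∀ x f, γ x f = QuotientAddGroup.mk (fun j => x j • f) := fun _ _ => rfl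
  have hker : φ.rangeRestrict.toAddMonoidHom.ker ≤ γ.ker := by
    intro x hx
    have hx' : colMap R N x = 0 := congrArg Subtype.val (show φ.rangeRestrict x = 0 from hx)
    obtain ⟨y, rfl⟩ := (hMN x).1 hx'
    rw [AddMonoidHom.mem_ker]
    ext f
    rw [hγ]
    refine (QuotientAddGroup.eq_zero_iff _).2 ⟨fun k => y k • f, ?_⟩
    ext i
    simp [colMap_apply, Finset.sum_smul, mul_smul]
  let σ := Function.surjInv φ.surjective_rangeRestrict
  have hσ : Function.RightInverse σ φ.rangeRestrict.toAddMonoidHom :=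
    Function.rightInverse_surjInv φ.surjective_rangeRestrict
  let β : C →+ F →+ Q := φ.rangeRestrict.toAddMonoidHom.liftOfRightInverse σ hσ ⟨γ, hker⟩
  have hβγ : ∀ x, β (φ.rangeRestrict x) = γ x := fun x =>
    AddMonoidHom.liftOfRightInverse_comp_apply _ _ hσ ⟨γ, hker⟩ x
  have hβ : ∀ (c : C) (r : R) f, β (MulOpposite.op r • c) f = β c (r • f) := by
    intro c r f
    obtain ⟨x, rfl⟩ := φ.surjective_rangeRestrict c
    rw [← map_smul, hβγ, hβγ, hγ, hγ]
    congr 1; ext j; simp [mul_smul]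
  have hinj := hF C (Fin c → R) C.subtype C.injective_subtype
  have key := RTensor.hom_ext_zero R Q β hβ
    (fun j : Fin b => φ.rangeRestrict (Pi.single j 1)) e ?_
  · simp only [hβγ, hγ] at key
    rw [← QuotientAddGroup.mk_sum, QuotientAddGroup.eq_zero_iff] at key
    obtain ⟨f, hf⟩ := key
    refine ⟨f, hf.trans ?_⟩
    ext j
    simp [Finset.sum_apply, Pi.single_apply, ite_smul]
  · apply hinj
    rw [map_zero]
    change (QuotientAddGroup.mk _ : RTensor R _ _) = 0
    have h2 : ∀ j : Fin b, φ (Pi.single j 1) =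
        ∑ i, MulOpposite.op (N i j) • (Pi.single i 1 : Fin c → R) := by
      intro j; ext i
      simp [hφ, colMap_apply, Pi.single_apply, Finset.sum_apply]
    simp only [map_sum]
    have h3 : ∀ (a : Fin c → R) (r : R) (f : F),
        (QuotientAddGroup.mk ((MulOpposite.op r • a) ⊗ₜ[ℤ] f) : RTensor R (Fin c → R) F) =
          QuotientAddGroup.mk (a ⊗ₜ[ℤ] (r • f)) := by
      intro a r f
      rw [← sub_eq_zero, ← QuotientAddGroup.mk_sub, QuotientAddGroup.eq_zero_iff]
      exact AddSubgroup.subset_closure ⟨a, r, f, rfl⟩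
    rw [QuotientAddGroup.mk_sum]
    have h4 : ∀ j : Fin b, (QuotientAddGroup.mk ((φ (Pi.single j 1)) ⊗ₜ[ℤ] e j) :
        RTensor R (Fin c → R) F) =
        ∑ i, QuotientAddGroup.mk ((Pi.single i 1 : Fin c → R) ⊗ₜ[ℤ] (N i j • e j)) := by
      intro j
      rw [h2, TensorProduct.sum_tmul, QuotientAddGroup.mk_sum]
      simp only [h3]
    refine (Finset.sum_congr rfl fun j _ => h4 j).trans ?_
    rw [Finset.sum_comm]
    refine Finset.sum_eq_zero fun i _ => ?_
    rw [← QuotientAddGroup.mk_sum, ← TensorProduct.tmul_sum]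
    have : ∑ j, N i j • e j = 0 := congrFun he i
    rw [this, TensorProduct.tmul_zero]; rfl

/-- The mirror argument: a matrix over `Rᵐᵒᵖ` acts on the rows over `R`, which gives a left linear
`φ`. -/
lemma RightFlat.preservesColExact {F : Type u} [AddCommGroup F] [Module Rᵐᵒᵖ F]
    (hF : RightFlat R F) : PreservesColExact Rᵐᵒᵖ F := by
  intro a b c M N hMN
  classical
  have hNM := mul_eq_zero_of_colMap_exact hMN
  intro e
  refine ⟨fun he => ?_, ?_⟩
  swap
  · rintro ⟨f, rfl⟩
    rw [colMap_colMap, hNM]; ext; simp [colMap_apply]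
  let φ : (Fin b → R) →ₗ[R] (Fin c → R) :=
    { toFun := fun x i => ∑ j, x j * (N i j).unop
      map_add' := by
        intro x y; ext i
        simp [add_mul, Finset.sum_add_distrib]
      map_smul' := by
        intro r x; ext i
        simp [Finset.mul_sum, mul_assoc] }
  have hφ : ∀ x i, φ x i = ∑ j, x j * (N i j).unop := fun _ _ => rfl
  let C := LinearMap.range φ
  let Q := (Fin b → F) ⧸ (colMap F M).range
  let γ : (Fin b → R) →+ (F →+ Q) :=
    { toFun := fun x => (QuotientAddGroup.mk' (colMap F M).range).comp
        { toFun := fun f j => MulOpposite.op (x j) • f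
          map_zero' := by ext; simp
          map_add' := by intros; ext; simp }
      map_zero' := by
        ext f
        refine (congrArg QuotientAddGroup.mk ?_).trans (QuotientAddGroup.mk_zero _)
        ext; simp
      map_add' := by
        intro x y; ext f
        simp only [AddMonoidHom.comp_apply, AddMonoidHom.add_apply]
        rw [← map_add]; congr 1; ext; simp [add_smul] }
  have hγ : ∀ x f, γ x f = QuotientAddGroup.mk (fun j => MulOpposite.op (x j) • f) :=
    fun _ _ => rfl
  have hker : φ.rangeRestrict.toAddMonoidHom.ker ≤ γ.ker := by
    intro x hx
    have hx' : φ x = 0 := congrArg Subtype.val (show φ.rangeRestrict x = 0 from hx)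
    obtain ⟨y, hy⟩ := (hMN fun j => MulOpposite.op (x j)).1 (by
      ext i
      have := congrFun hx' i
      rw [hφ] at this
      refine MulOpposite.unop_injective ?_
      simpa [colMap_apply] using this)
    rw [AddMonoidHom.mem_ker]
    ext f
    rw [hγ]
    refine (QuotientAddGroup.eq_zero_iff _).2 ⟨fun k => y k • f, ?_⟩
    ext i
    rw [← congrFun hy i]
    simp only [colMap_apply, Finset.sum_smul, smul_eq_mul, mul_smul]
  let σ := Function.surjInv φ.surjective_rangeRestrict
  have hσ : Function.RightInverse σ φ.rangeRestrict.toAddMonoidHom :=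
    Function.rightInverse_surjInv φ.surjective_rangeRestrict
  let β : C →+ F →+ Q := φ.rangeRestrict.toAddMonoidHom.liftOfRightInverse σ hσ ⟨γ, hker⟩
  have hβγ : ∀ x, β (φ.rangeRestrict x) = γ x := fun x =>
    AddMonoidHom.liftOfRightInverse_comp_apply _ _ hσ ⟨γ, hker⟩ x
  have hβ : ∀ (f : F) (r : R) (c : C),
      β.flip (MulOpposite.op r • f) c = β.flip f (r • c) := by
    intro f r c
    obtain ⟨x, rfl⟩ := φ.surjective_rangeRestrict c
    rw [← map_smul, AddMonoidHom.flip_apply, AddMonoidHom.flip_apply, hβγ, hβγ, hγ, hγ]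
    congr 1; ext j; simp [mul_smul]
  have hinj := hF C (Fin c → R) C.subtype C.injective_subtype
  have key := RTensor.hom_ext_zero R Q β.flip hβ e
    (fun j : Fin b => φ.rangeRestrict (Pi.single j 1)) ?_
  · simp only [AddMonoidHom.flip_apply, hβγ, hγ] at key
    rw [← QuotientAddGroup.mk_sum, QuotientAddGroup.eq_zero_iff] at key
    obtain ⟨f, hf⟩ := key
    refine ⟨f, hf.trans ?_⟩
    ext j
    simp [Finset.sum_apply, Pi.single_apply, apply_ite MulOpposite.op, ite_smul]
  · apply hinj
    rw [map_zero]
    change (QuotientAddGroup.mk _ : RTensor R _ _) = 0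
    have h2 : ∀ j : Fin b, φ (Pi.single j 1) =
        ∑ i, (N i j).unop • (Pi.single i 1 : Fin c → R) := by
      intro j; ext i
      simp [hφ, Pi.single_apply, Finset.sum_apply]
    simp only [map_sum]
    have h3 : ∀ (a : Fin c → R) (r : R) (f : F),
        (QuotientAddGroup.mk (f ⊗ₜ[ℤ] (r • a)) : RTensor R F (Fin c → R)) =
          QuotientAddGroup.mk ((MulOpposite.op r • f) ⊗ₜ[ℤ] a) := by
      intro a r f
      symm
      rw [← sub_eq_zero, ← QuotientAddGroup.mk_sub, QuotientAddGroup.eq_zero_iff]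
      exact AddSubgroup.subset_closure ⟨f, r, a, rfl⟩
    rw [QuotientAddGroup.mk_sum]
    have h4 : ∀ j : Fin b, (QuotientAddGroup.mk (e j ⊗ₜ[ℤ] (φ (Pi.single j 1))) :
        RTensor R F (Fin c → R)) =
        ∑ i, QuotientAddGroup.mk ((N i j • e j) ⊗ₜ[ℤ] (Pi.single i 1 : Fin c → R)) := by
      intro j
      rw [h2, TensorProduct.tmul_sum, QuotientAddGroup.mk_sum]
      simp only [h3, MulOpposite.op_unop]
    refine (Finset.sum_congr rfl fun j _ => h4 j).trans ?_
    rw [Finset.sum_comm]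
    refine Finset.sum_eq_zero fun i _ => ?_
    rw [← QuotientAddGroup.mk_sum, ← TensorProduct.sum_tmul]
    have : ∑ j, N i j • e j = 0 := congrFun he i
    rw [this, TensorProduct.zero_tmul]; rfl

end Flat

/-! ### Flat dimension and exactness by dimension shifting. -/

/-- `ColExactFor n N`: the map on columns given by `N` is the start of a sequence of matrices
that is exact at its next `n` places. -/
def ColExactFor (S : Type*) [Ring S] : ℕ → ∀ {b c : ℕ}, Matrix (Fin c) (Fin b) S → Prop
  | 0, _, _, _ => True
  | n + 1, _, c, M => ∃ (d : ℕ) (N : Matrix (Fin d) (Fin c) S),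
      Function.Exact (colMap S M) (colMap S N) ∧ ColExactFor S n N

/-- Use 0 → K → F → E → 0. Lift a cycle over E to y over F. Then N y lies in K and is a cycle for
the next matrix, so by induction N y = N z with z over K. Now y - z is a cycle over F, hence a
boundary, and it still maps to the given cycle. Each unit of flat dimension costs one further exact
place; since `n` bounds the dimension by n - 1, that is n - 1 places. -/
lemma colMap_exact_of_hasResolutionLT {S : Type u} [Ring S] {P : ModuleCat.{u} S → Prop}
    (hP : ∀ F, P F → PreservesColExact S F) {n : ℕ} :
    ∀ {E : ModuleCat.{u} S}, HasResolutionLT P n E →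
      ∀ {a b c : ℕ} (M : Matrix (Fin b) (Fin a) S) (N : Matrix (Fin c) (Fin b) S),
        Function.Exact (colMap S M) (colMap S N) → ColExactFor S (n - 1) N →
          Function.Exact (colMap E M) (colMap E N) := by
  induction n with
  | zero =>
    intro E hE a b c M N _ _ e
    have : Subsingleton E := hE
    exact ⟨fun _ => ⟨0, Subsingleton.elim _ _⟩, fun _ => Subsingleton.elim _ _⟩
  | succ n ih =>
    rintro E ⟨F, f, hF, hf, hK⟩ a b c M N hMN hN e
    classical
    have hNM := mul_eq_zero_of_colMap_exact hMN
    refine ⟨fun he => ?_, ?_⟩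
    swap
    · rintro ⟨f, rfl⟩
      rw [colMap_colMap, hNM]; ext; simp [colMap_apply]
    choose y hy using fun j => hf (e j)
    have hfy : ∀ i, f (colMap F N y i) = 0 := fun i => by
      rw [← congrFun (colMap_comp_linearMap f N y) i]
      simp only [hy]
      exact congrFun he i
    have hz : ∃ z : Fin b → LinearMap.ker f, ∀ i,
        colMap (LinearMap.ker f) N z i = (⟨colMap F N y i, hfy i⟩ : LinearMap.ker f) := by
      -- In dimension ≤ 0 the kernel is zero, so no exactness beyond `N` is needed.
      rcases n with _ | n
      · have : Subsingleton (LinearMap.ker f) := hK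
        exact ⟨0, fun i => Subsingleton.elim _ _⟩
      · obtain ⟨d, L, hNL, hL⟩ := hN
        have := ih hK N L hNL hL (fun i => ⟨colMap F N y i, hfy i⟩)
        obtain ⟨z, hz⟩ := this.1 (by
          ext i
          have h1 := congrFun (colMap_comp_linearMap (LinearMap.ker f).subtype L
            (fun i => (⟨colMap F N y i, hfy i⟩ : LinearMap.ker f))) i
          refine h1.symm.trans ?_
          change colMap F L (colMap F N y) i = 0
          rw [colMap_colMap, mul_eq_zero_of_colMap_exact hNL]; simp [colMap_apply])
        exact ⟨z, congrFun hz⟩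
    obtain ⟨z, hz⟩ := hz
    obtain ⟨w, hw⟩ := (hP F hF M N hMN (y - fun j => (z j : F))).1 (by
      rw [map_sub, sub_eq_zero]
      ext i
      have h1 := congrFun (colMap_comp_linearMap (LinearMap.ker f).subtype N z) i
      exact (h1.trans (congrArg Subtype.val (hz i))).symm)
    refine ⟨fun k => f (w k), ?_⟩
    rw [colMap_comp_linearMap, hw]
    ext j
    simp [hy]

lemma colMap_exact_of_retract {S : Type*} [Ring S] {E F : Type*} [AddCommGroup E] [Module S E]
    [AddCommGroup F] [Module S F] (i : F →ₗ[S] E) (p : E →ₗ[S] F) (hip : ∀ x, p (i x) = x)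
    {a b c : ℕ} {M : Matrix (Fin b) (Fin a) S} {N : Matrix (Fin c) (Fin b) S}
    (h : Function.Exact (colMap E M) (colMap E N)) :
    Function.Exact (colMap F M) (colMap F N) := by
  intro e
  constructor
  · intro he
    obtain ⟨f, hf⟩ := (h fun j => i (e j)).1 (by
      rw [colMap_comp_linearMap, he]; ext; simp)
    refine ⟨fun k => p (f k), ?_⟩
    rw [colMap_comp_linearMap, hf]
    ext; simp [hip]
  · rintro ⟨f, rfl⟩
    have := (h fun j => i (colMap F M f j)).2 ⟨fun k => i (f k), colMap_comp_linearMap _ _ _⟩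
    rw [colMap_comp_linearMap] at this
    ext j
    simpa [hip] using congrArg p (congrFun this j)

/-! ### Ext classes as maps into an injective resolution. -/

section InjectiveResolution

open Abelian Limits

universe w v u'

variable {C : Type u'} [Category.{v} C] [Abelian C]

/-- The short complex `Ker dⁱ → Iⁱ → Ker dⁱ⁺¹` of a cochain complex. -/
noncomputable abbrev cosyzygyComplex (K : CochainComplex C ℕ) (i : ℕ) : ShortComplex C :=
  ShortComplex.mk (kernel.ι (K.d i (i + 1)))
    (kernel.lift (K.d (i + 1) (i + 2)) (K.d i (i + 1)) (K.d_comp_d _ _ _))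
    (by rw [← cancel_mono (kernel.ι _)]; simp)

lemma cosyzygyComplex_shortExact {M : C} (I : InjectiveResolution M) (i : ℕ) :
    (cosyzygyComplex I.cocomplex i).ShortExact := by
  have hepi : Epi (cosyzygyComplex I.cocomplex i).g := (I.exact_succ i).epi_kernelLift
  have hex : (cosyzygyComplex I.cocomplex i).Exact := by
    refine ShortComplex.exact_of_f_is_kernel _ ?_
    refine KernelFork.IsLimit.ofι' _ _ fun {T} k hk => ?_
    have hk' : k ≫ I.cocomplex.d i (i + 1) = 0 := by
      simpa using congrArg (fun t => t ≫ kernel.ι (I.cocomplex.d (i + 1) (i + 2))) hk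
    exact ⟨kernel.lift _ k hk', kernel.lift_ι _ _ _⟩
  exact { exact := hex, mono_f := inferInstanceAs (Mono (kernel.ι _)), epi_g := hepi }

variable [HasExt.{w} C]

/-- With Z^j = Ker d^j, the sequence 0 → Z^j → I^j → Z^{j+1} → 0 and injectivity of I^j exhibit a
class of degree m + 1 as the connecting image of one of degree m. Iterating ends at a map N → Z^a ⊆
I^a. Restriction along `i` commutes with connecting maps, so only this map matters. -/
lemma exists_hom_of_ext_kernel {M : C} (I : InjectiveResolution M) {N : C} (m : ℕ) :
    ∀ (j a : ℕ) (_ : a = j + m) (e : Ext N (kernel (I.cocomplex.d j (j + 1))) m),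
      ∃ g : N ⟶ I.cocomplex.X a, ∀ {A : C} (i : A ⟶ N), i ≫ g = 0 →
        (Ext.mk₀ i).comp e (zero_add m) = 0 := by
  induction m with
  | zero =>
    rintro j a rfl e
    obtain ⟨φ, rfl⟩ := Ext.mk₀_bijective _ _ |>.2 e
    refine ⟨φ ≫ kernel.ι _, fun i hi => ?_⟩
    rw [Ext.mk₀_comp_mk₀, Ext.mk₀_eq_zero_iff, ← cancel_mono (kernel.ι _)]
    simpa using hi
  | succ m ih =>
    rintro j a ha e
    have hS := cosyzygyComplex_shortExact I j
    obtain ⟨e', rfl⟩ := Ext.covariant_sequence_exact₁ N hS e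
      (@Ext.eq_zero_of_injective _ _ _ _ _ _ _ (I.injective j) _) rfl
    obtain ⟨g, hg⟩ := ih (j + 1) a (by omega) e'
    refine ⟨g, fun i hi => ?_⟩
    rw [← Ext.comp_assoc _ _ _ (zero_add m) rfl (by omega), hg i hi, Ext.zero_comp]

/-- A class in `Extᵐ(N, M)` is represented by a map `N ⟶ Iᵐ`, and it restricts to zero wherever
this map does. -/
lemma exists_hom_of_ext {M : C} (I : InjectiveResolution M) {N : C} {m : ℕ} (e : Ext N M m) :
    ∃ g : N ⟶ I.cocomplex.X m, ∀ {A : C} (i : A ⟶ N), i ≫ g = 0 →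
        (Ext.mk₀ i).comp e (zero_add m) = 0 := by
  let φ : M ≅ kernel (I.cocomplex.d 0 1) :=
    (HomologicalComplex.singleObjXSelf (ComplexShape.up ℕ) 0 M).symm ≪≫
    I.isLimitKernelFork.conePointUniqueUpToIso (limit.isLimit _)
  obtain ⟨g, hg⟩ := exists_hom_of_ext_kernel I m 0 m (zero_add m).symm
    (e.comp (Ext.mk₀ φ.hom) (add_zero m))
  refine ⟨g, fun i hi => ?_⟩
  have h := congrArg (fun t => t.comp (Ext.mk₀ φ.inv) (add_zero m)) (hg i hi)
  simpa [Ext.comp_assoc_of_third_deg_zero] using h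

lemma ext_eq_zero_of_forall_hom {M : C} (I : InjectiveResolution M) {N : C} {m : ℕ}
    (h : ∀ g : N ⟶ I.cocomplex.X m, g = 0) (e : Ext N M m) : e = 0 := by
  obtain ⟨g, hg⟩ := exists_hom_of_ext I e
  simpa using hg (𝟙 N) (by simp [h g])

end InjectiveResolution

/-! ### The left module structure on Ext(A, Λ). -/

section LeftModule

open Abelian

variable {Λ : Type u} [Ring Λ]

/-- `Extᵏ(A, Λ)` for a right module `A`, with its structure of a left `Λ`-module. -/
noncomputable instance extModule (A : ModuleCat.{u} Λᵐᵒᵖ) (k : ℕ) :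
    Module Λ (Ext A (ModuleCat.of Λᵐᵒᵖ Λ) k) where
  smul c x := x.comp (Ext.mk₀ (ModuleCat.ofHom (Module.toModuleEnd Λᵐᵒᵖ Λ c))) (add_zero k)
  one_smul x := by
    change x.comp (Ext.mk₀ (ModuleCat.ofHom (Module.toModuleEnd Λᵐᵒᵖ Λ 1))) (add_zero k) = x
    rw [map_one]; exact Ext.comp_mk₀_id x
  mul_smul c c' x := by
    change x.comp (Ext.mk₀ (ModuleCat.ofHom (Module.toModuleEnd Λᵐᵒᵖ Λ (c * c')))) (add_zero k) =
      (x.comp (Ext.mk₀ (ModuleCat.ofHom (Module.toModuleEnd Λᵐᵒᵖ Λ c'))) (add_zero k)).comp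
        (Ext.mk₀ (ModuleCat.ofHom (Module.toModuleEnd Λᵐᵒᵖ Λ c))) (add_zero k)
    rw [map_mul, Ext.comp_assoc_of_third_deg_zero, Ext.mk₀_comp_mk₀]; rfl
  smul_zero c := by
    change (0 : Ext _ _ _).comp (Ext.mk₀ (ModuleCat.ofHom (Module.toModuleEnd Λᵐᵒᵖ Λ c)))
      (add_zero k) = 0
    rw [Ext.zero_comp]
  smul_add c x y := Ext.add_comp x y (Ext.mk₀ (ModuleCat.ofHom (Module.toModuleEnd Λᵐᵒᵖ Λ c)))
    (add_zero k)
  zero_smul x := by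
    change x.comp (Ext.mk₀ (ModuleCat.ofHom (Module.toModuleEnd Λᵐᵒᵖ Λ 0))) (add_zero k) = 0
    rw [map_zero, ModuleCat.ofHom_zero, Ext.mk₀_zero, Ext.comp_zero]
  add_smul c c' x := by
    change x.comp (Ext.mk₀ (ModuleCat.ofHom (Module.toModuleEnd Λᵐᵒᵖ Λ (c + c')))) (add_zero k) =
      x.comp (Ext.mk₀ (ModuleCat.ofHom (Module.toModuleEnd Λᵐᵒᵖ Λ c))) (add_zero k) +
      x.comp (Ext.mk₀ (ModuleCat.ofHom (Module.toModuleEnd Λᵐᵒᵖ Λ c'))) (add_zero k)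
    rw [map_add, ModuleCat.ofHom_add, Ext.mk₀_add, Ext.comp_add]

lemma ext_smul_def {A : ModuleCat.{u} Λᵐᵒᵖ} {k : ℕ} (c : Λ) (x : Ext A (ModuleCat.of Λᵐᵒᵖ Λ) k) :
    c • x = x.comp (Ext.mk₀ (ModuleCat.ofHom (Module.toModuleEnd Λᵐᵒᵖ Λ c))) (add_zero k) := rfl

/-- Precomposition with a class, as a homomorphism of left modules. -/
noncomputable def extPrecomp {A B : ModuleCat.{u} Λᵐᵒᵖ} {n m p : ℕ} (e : Ext A B n)
    (h : n + m = p) :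
    Ext B (ModuleCat.of Λᵐᵒᵖ Λ) m →ₗ[Λ] Ext A (ModuleCat.of Λᵐᵒᵖ Λ) p where
  toFun x := e.comp x h
  map_add' x y := Ext.comp_add _ _ _ _
  map_smul' c x := by
    simp only [ext_smul_def, RingHom.id_apply]
    rw [Ext.comp_assoc_of_third_deg_zero]

/-- `Hom(A, Λ) ≃ Ext⁰(A, Λ)` as left modules. -/
noncomputable def homEquivExt (A : ModuleCat.{u} Λᵐᵒᵖ) :
    (A →ₗ[Λᵐᵒᵖ] Λ) ≃ₗ[Λ] Ext A (ModuleCat.of Λᵐᵒᵖ Λ) 0 :=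
  LinearEquiv.ofBijective
    { toFun := fun f => Ext.mk₀ (ModuleCat.ofHom f)
      map_add' := fun f g => by rw [ModuleCat.ofHom_add, Ext.mk₀_add]
      map_smul' := fun c f => by
        rw [RingHom.id_apply, ext_smul_def, Ext.mk₀_comp_mk₀]; rfl }
    ((Ext.mk₀_bijective _ _).comp
      (ModuleCat.homEquiv (M := A) (N := ModuleCat.of Λᵐᵒᵖ Λ)).symm.bijective)

end LeftModule

/-! ### Free resolutions by matrices and the computation of Ext. -/

section Resolution

open Abelian Matrix

variable {Λ : Type u} [Ring Λ]

/-- The homomorphism of free right modules given by a matrix acting on columns. -/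
def colMapLinear {m n : Type*} [Fintype n] (D : Matrix m n Λ) : (n → Λ) →ₗ[Λᵐᵒᵖ] (m → Λ) where
  __ := colMap Λ D
  map_smul' r x := by
    ext i
    simp [colMap_apply, Finset.sum_mul, mul_assoc]

lemma colMap_eq_mulVec {m n : Type*} [Fintype n] (D : Matrix m n Λ) (x : n → Λ) :
    colMap Λ D x = D *ᵥ x := rfl

/-- The homomorphism of right modules `Λⁿ → Λ` given by the dot product with a row. -/
def dotLinear {n : Type*} [Fintype n] (p : n → Λ) : (n → Λ) →ₗ[Λᵐᵒᵖ] Λ where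
  toFun x := p ⬝ᵥ x
  map_add' := dotProduct_add p
  map_smul' r x := by simp [dotProduct, Finset.sum_mul, mul_assoc]

@[simp] lemma dotLinear_apply {n : Type*} [Fintype n] (p x : n → Λ) : dotLinear p x = p ⬝ᵥ x := rfl

lemma linearMap_eq_sum {n : Type*} [Fintype n] [DecidableEq n] {M : Type*} [AddCommGroup M]
    [Module Λᵐᵒᵖ M] (f : (n → Λ) →ₗ[Λᵐᵒᵖ] M) (x : n → Λ) :
    f x = ∑ j, MulOpposite.op (x j) • f (Pi.single j 1) := by
  simp only [← map_smul, ← map_sum]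
  congr 1
  ext i
  simp [Finset.sum_apply, Pi.single_apply]

lemma eq_dotLinear {n : Type*} [Fintype n] [DecidableEq n] (f : (n → Λ) →ₗ[Λᵐᵒᵖ] Λ) :
    f = dotLinear fun j => f (Pi.single j 1) := by
  refine LinearMap.ext fun x => ?_
  rw [linearMap_eq_sum]
  simp [dotProduct]

lemma eq_of_forall_dotProduct {n : Type*} [Fintype n] {p q : n → Λ}
    (h : ∀ x, p ⬝ᵥ x = q ⬝ᵥ x) : p = q := by
  classical
  ext j
  simpa using h (Pi.single j 1)

variable {a b c : ℕ}

/-- `Hom(A, Λ)` for a module `A` presented by a matrix `D` consists of the rows killed by `D`. -/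
lemma exists_homEquiv_of_presentation {A : Type u} [AddCommGroup A] [Module Λᵐᵒᵖ A]
    {D : Matrix (Fin b) (Fin a) Λ} {ε : (Fin b → Λ) →ₗ[Λᵐᵒᵖ] A} (hε : Function.Surjective ε)
    (hD : Function.Exact (colMap Λ D) ε) :
    ∃ σ : LinearMap.ker (vecMulLinear D) ≃ₗ[Λ] (A →ₗ[Λᵐᵒᵖ] Λ),
      ∀ p x, σ p (ε x) = p.1 ⬝ᵥ x := by
  let τ : (A →ₗ[Λᵐᵒᵖ] Λ) →ₗ[Λ] LinearMap.ker (vecMulLinear D) :=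
    { toFun := fun f => ⟨fun j => f (ε (Pi.single j 1)), by
        rw [LinearMap.mem_ker]
        refine eq_of_forall_dotProduct fun x => ?_
        rw [vecMulLinear_apply, ← dotProduct_mulVec, zero_dotProduct, ← dotLinear_apply]
        have h := eq_dotLinear (f ∘ₗ ε)
        simp only [LinearMap.comp_apply] at h
        rw [← h, LinearMap.comp_apply, ← colMap_eq_mulVec, hD.apply_apply_eq_zero, map_zero]⟩
      map_add' := fun f g => by ext; simp
      map_smul' := fun c f => by ext; simp }
  have hτ : ∀ f x, f (ε x) = (τ f).1 ⬝ᵥ x := fun f x =>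
    congrFun (congrArg DFunLike.coe (eq_dotLinear (f ∘ₗ ε))) x
  have hbij : Function.Bijective τ := by
    constructor
    · intro f g hfg
      ext y
      obtain ⟨x, rfl⟩ := hε y
      rw [hτ, hτ, hfg]
    · rintro ⟨p, hp⟩
      have hle : LinearMap.ker ε ≤ LinearMap.ker (dotLinear p) := by
        intro x hx
        obtain ⟨y, rfl⟩ := (hD x).1 hx
        rw [LinearMap.mem_ker, dotLinear_apply, colMap_eq_mulVec, dotProduct_mulVec]
        rw [show p ᵥ* D = 0 from hp, zero_dotProduct]
      refine ⟨(LinearMap.ker ε).liftQ (dotLinear p) hle ∘ₗ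
        (ε.quotKerEquivOfSurjective hε).symm.toLinearMap, ?_⟩
      refine Subtype.ext (eq_of_forall_dotProduct fun x => ?_)
      rw [← hτ]
      have : (ε.quotKerEquivOfSurjective hε).symm (ε x) = Submodule.Quotient.mk x := by
        rw [LinearEquiv.symm_apply_eq]; rfl
      simp [this]
  refine ⟨(LinearEquiv.ofBijective τ hbij).symm, fun p x => ?_⟩
  rw [hτ]
  congr 2
  exact (LinearEquiv.ofBijective τ hbij).apply_symm_apply p

/-- The projection of a free module onto the image of a matrix, that is, onto the kernel of the
next map. -/
lemma exists_syzygy {A : Type u} [AddCommGroup A] [Module Λᵐᵒᵖ A]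
    {D : Matrix (Fin b) (Fin a) Λ} {ε : (Fin b → Λ) →ₗ[Λᵐᵒᵖ] A}
    (hD : Function.Exact (colMap Λ D) ε) :
    ∃ ε' : (Fin a → Λ) →ₗ[Λᵐᵒᵖ] LinearMap.ker ε, Function.Surjective ε' ∧
      ∀ x, (ε' x : Fin b → Λ) = colMap Λ D x := by
  refine ⟨(colMapLinear D).codRestrict _ fun x => hD.apply_apply_eq_zero x, ?_, fun _ => rfl⟩
  rintro ⟨y, hy⟩
  obtain ⟨x, rfl⟩ := (hD y).1 hy
  exact ⟨x, rfl⟩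

instance (n : ℕ) : Projective (ModuleCat.of Λᵐᵒᵖ (Fin n → Λ)) := by
  let e : Λᵐᵒᵖ ≃ₗ[Λᵐᵒᵖ] Λ :=
    { MulOpposite.opAddEquiv.symm with map_smul' := fun r x => by simp }
  have : Module.Free Λᵐᵒᵖ Λ := Module.Free.of_equiv e
  exact (IsProjective.iff_projective _).1 inferInstance

/-- Ext¹(A,Λ) is the cokernel of Hom(Λ^b,Λ) → Hom(ker ε,Λ), as Λ^b is projective. Maps on ker ε are
the rows killed by `D'`, and restricting the row q from Λ^b yields q D. -/
lemma exists_ext_one_presentation {A : Type u} [AddCommGroup A] [Module Λᵐᵒᵖ A]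
    {D : Matrix (Fin b) (Fin a) Λ} {D' : Matrix (Fin a) (Fin c) Λ}
    {ε : (Fin b → Λ) →ₗ[Λᵐᵒᵖ] A} (hε : Function.Surjective ε)
    (hD : Function.Exact (colMap Λ D) ε) (hD' : Function.Exact (colMap Λ D') (colMap Λ D)) :
    ∃ σ : LinearMap.ker (vecMulLinear D') →ₗ[Λ]
        Ext (ModuleCat.of Λᵐᵒᵖ A) (ModuleCat.of Λᵐᵒᵖ Λ) 1,
      Function.Surjective σ ∧ ∀ p, σ p = 0 ↔ ∃ q, q ᵥ* D = p := by
  obtain ⟨ε', hε', hε'D⟩ := exists_syzygy hD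
  have hD'ε : Function.Exact (colMap Λ D') ε' := fun x => by
    rw [← hD' x, ← hε'D, Submodule.coe_eq_zero]
  obtain ⟨σ, hσ⟩ := exists_homEquiv_of_presentation hε' hD'ε
  have hS := LinearMap.shortExact_shortComplexKer hε
  have hsurj := precomp_extClass_surjective_of_projective_X₂ (ModuleCat.of Λᵐᵒᵖ Λ) hS 0
  refine ⟨extPrecomp hS.extClass (add_comm 1 0) ∘ₗ
    (homEquivExt (ModuleCat.of Λᵐᵒᵖ (LinearMap.ker ε))).toLinearMap ∘ₗ σ.toLinearMap,
    hsurj.comp ((homEquivExt (ModuleCat.of Λᵐᵒᵖ (LinearMap.ker ε))).surjective.comp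
      σ.surjective), fun p => ?_⟩
  constructor
  · intro h
    obtain ⟨x, hx⟩ := Ext.contravariant_sequence_exact₁ hS _ _ (add_comm 1 0) h
    obtain ⟨f, rfl⟩ := (Ext.mk₀_bijective _ _).2 x
    rw [Ext.mk₀_comp_mk₀] at hx
    have hx' := (Ext.mk₀_bijective _ _).1 hx
    refine ⟨fun j => f.hom (Pi.single j 1), ?_⟩
    have h2 := eq_dotLinear f.hom
    refine eq_of_forall_dotProduct fun x => ?_
    rw [← dotProduct_mulVec, ← hσ]
    have h3 := congrArg (fun t => t.hom (ε' x)) hx'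
    refine Eq.trans ?_ h3
    refine (congrFun (congrArg DFunLike.coe h2) _).symm.trans ?_
    exact congrArg f.hom (hε'D x).symm
  · rintro ⟨q, hq⟩
    have h1 : ModuleCat.ofHom (σ p) = (ModuleCat.ofHom (LinearMap.ker ε).subtype) ≫
        (ModuleCat.ofHom (dotLinear q) : ModuleCat.of Λᵐᵒᵖ (Fin b → Λ) ⟶ ModuleCat.of Λᵐᵒᵖ Λ) := by
      ext z
      obtain ⟨x, rfl⟩ := hε' z
      refine (hσ p x).trans ?_
      rw [← hq, ← dotProduct_mulVec, ← colMap_eq_mulVec, ← hε'D]; rfl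
    change hS.extClass.comp (Ext.mk₀ (ModuleCat.ofHom (σ p))) (add_comm 1 0) = 0
    rw [h1, ← Ext.mk₀_comp_mk₀]
    exact hS.extClass_comp_assoc _

/-- Dimension shifting along syzygies. The module may be resolved from any place `j` of the
sequence, so that the induction hypothesis applies to ker ε. -/
lemma exists_ext_succ_presentation (r : ℕ → ℕ) (d : ∀ j, Matrix (Fin (r j)) (Fin (r (j + 1))) Λ)
    (hd : ∀ j, Function.Exact (colMap Λ (d (j + 2))) (colMap Λ (d (j + 1)))) (k : ℕ) :
    ∀ (j i : ℕ) (_ : i = j + k) (A : Type u) [AddCommGroup A] [Module Λᵐᵒᵖ A]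
      (ε : (Fin (r (j + 1)) → Λ) →ₗ[Λᵐᵒᵖ] A), Function.Surjective ε →
      Function.Exact (colMap Λ (d (j + 1))) ε →
    ∃ σ : LinearMap.ker (vecMulLinear (d (i + 2))) →ₗ[Λ]
        Ext (ModuleCat.of Λᵐᵒᵖ A) (ModuleCat.of Λᵐᵒᵖ Λ) (k + 1),
      Function.Surjective σ ∧ ∀ p, σ p = 0 ↔ ∃ q, q ᵥ* d (i + 1) = p := by
  induction k with
  | zero =>
    rintro j i rfl A _ _ ε hε hε1
    exact exists_ext_one_presentation hε hε1 (hd _)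
  | succ k ih =>
    rintro j i hi A _ _ ε hε hε1
    obtain ⟨ε', hε', hε'D⟩ := exists_syzygy hε1
    have hε'1 : Function.Exact (colMap Λ (d (j + 2))) ε' := fun x => by
      rw [← hd j x, ← hε'D, Submodule.coe_eq_zero]
    obtain ⟨σ, hσ, hσ0⟩ := ih (j + 1) i (by omega) (LinearMap.ker ε) ε' hε' hε'1
    have hS := LinearMap.shortExact_shortComplexKer hε
    have hsurj := precomp_extClass_surjective_of_projective_X₂ (ModuleCat.of Λᵐᵒᵖ Λ) hS (k + 1)
    refine ⟨extPrecomp hS.extClass (add_comm 1 (k + 1)) ∘ₗ σ, hsurj.comp hσ, fun p => ?_⟩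
    rw [← hσ0]
    constructor
    · intro h
      obtain ⟨x, hx⟩ := Ext.contravariant_sequence_exact₁ hS _ _ (add_comm 1 (k + 1)) h
      have : Projective ε.shortComplexKer.X₂ :=
        inferInstanceAs (Projective (ModuleCat.of Λᵐᵒᵖ (Fin _ → Λ)))
      -- The connecting map is injective, because positive Ext of the free middle term vanishes.
      rw [Ext.eq_zero_of_projective x, Ext.comp_zero] at hx
      exact hx.symm
    · intro h
      rw [LinearMap.comp_apply, h, map_zero]

/-- A resolution `⋯ → Λ^{r 2} → Λ^{r 1} → A → 0` of a right module by finitely generated free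
modules, the maps being given by matrices; the complex is continued by `Λ^{r 0} = 0`. -/
structure MatrixResolution (Λ : Type u) [Ring Λ] (A : Type u) [AddCommGroup A]
    [Module Λᵐᵒᵖ A] where
  /-- the ranks -/
  r : ℕ → ℕ
  /-- the matrices -/
  d : ∀ j, Matrix (Fin (r j)) (Fin (r (j + 1))) Λ
  /-- the augmentation -/
  ε : (Fin (r 1) → Λ) →ₗ[Λᵐᵒᵖ] A
  r_zero : r 0 = 0
  surjective : Function.Surjective ε
  exact_zero : Function.Exact (colMap Λ (d 1)) ε
  exact_succ : ∀ j, Function.Exact (colMap Λ (d (j + 2))) (colMap Λ (d (j + 1)))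

/-- `Extᵏ(A, Λ)` is, as a left module, the cohomology of the dual of a resolution. -/
lemma MatrixResolution.exists_ext_presentation {A : Type u} [AddCommGroup A] [Module Λᵐᵒᵖ A]
    (P : MatrixResolution Λ A) (k : ℕ) :
    ∃ σ : LinearMap.ker (vecMulLinear (P.d (k + 1))) →ₗ[Λ]
        Ext (ModuleCat.of Λᵐᵒᵖ A) (ModuleCat.of Λᵐᵒᵖ Λ) k,
      Function.Surjective σ ∧ ∀ p, σ p = 0 ↔ ∃ q, q ᵥ* P.d k = p := by
  rcases k with _ | k
  · obtain ⟨σ, hσ⟩ := exists_homEquiv_of_presentation P.surjective P.exact_zero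
    refine ⟨(homEquivExt (ModuleCat.of Λᵐᵒᵖ A)).toLinearMap ∘ₗ σ.toLinearMap,
      (homEquivExt (ModuleCat.of Λᵐᵒᵖ A)).surjective.comp σ.surjective, fun p => ?_⟩
    -- As `P.r 0 = 0`, there are no nonzero coboundaries in degree 0, which matches the injectivity
    -- of `σ`.
    have : IsEmpty (Fin (P.r 0)) := by rw [P.r_zero]; infer_instance
    rw [LinearMap.comp_apply, LinearEquiv.coe_coe, LinearEquiv.coe_coe, map_eq_zero_iff _
      (LinearEquiv.injective _), map_eq_zero_iff _ σ.injective]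
    constructor
    · rintro rfl
      exact ⟨0, zero_vecMul _⟩
    · rintro ⟨q, hq⟩
      rw [Subsingleton.elim q 0, zero_vecMul] at hq
      exact Subtype.ext hq.symm
  · exact exists_ext_succ_presentation P.r P.d P.exact_succ k 0 k (zero_add k).symm A P.ε
      P.surjective P.exact_zero

lemma exists_matrix_of_fg {b : ℕ} {Z : Submodule Λᵐᵒᵖ (Fin b → Λ)} (hZ : Z.FG) :
    ∃ (a : ℕ) (D : Matrix (Fin b) (Fin a) Λ), ∀ x, x ∈ Z ↔ x ∈ Set.range (colMap Λ D) := by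
  obtain ⟨n, v, hv⟩ := Submodule.fg_iff_exists_fin_generating_family.1 hZ
  refine ⟨n, Matrix.of fun i j => v j i, fun x => ?_⟩
  rw [← hv, Submodule.mem_span_range_iff_exists_fun]
  constructor
  · rintro ⟨c, rfl⟩
    exact ⟨fun j => (c j).unop, by ext i; simp [colMap_apply, Finset.sum_apply]⟩
  · rintro ⟨c, rfl⟩
    exact ⟨fun j => MulOpposite.op (c j), by ext i; simp [colMap_apply, Finset.sum_apply]⟩

/-- Submodules of Λ^b are finitely generated, so each kernel is the image of a further matrix. The
recursion carries a matrix together with its two sizes. -/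
lemma exists_matrixResolution [IsNoetherianRing Λᵐᵒᵖ] (A : Type u) [AddCommGroup A]
    [Module Λᵐᵒᵖ A] [Module.Finite Λᵐᵒᵖ A] : Nonempty (MatrixResolution Λ A) := by
  have hfin : Module.Finite Λᵐᵒᵖ Λ := by
    let e : Λᵐᵒᵖ ≃ₗ[Λᵐᵒᵖ] Λ :=
      { MulOpposite.opAddEquiv.symm with map_smul' := fun r x => by simp }
    exact Module.Finite.equiv e
  have hfg : ∀ {b : ℕ} (Z : Submodule Λᵐᵒᵖ (Fin b → Λ)), Z.FG := fun Z =>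
    IsNoetherian.noetherian Z
  obtain ⟨n, v, hv⟩ := Module.Finite.exists_fin (R := Λᵐᵒᵖ) (M := A)
  let ε : (Fin n → Λ) →ₗ[Λᵐᵒᵖ] A :=
    { toFun := fun x => ∑ j, MulOpposite.op (x j) • v j
      map_add' := fun x y => by simp [add_smul, Finset.sum_add_distrib]
      map_smul' := fun c x => by simp [Finset.smul_sum, mul_smul] }
  have hε : Function.Surjective ε := fun y => by
    have hy : y ∈ Submodule.span Λᵐᵒᵖ (Set.range v) := hv ▸ Submodule.mem_top
    obtain ⟨c, hc⟩ := Submodule.mem_span_range_iff_exists_fun _ |>.1 hy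
    exact ⟨fun j => (c j).unop, hc⟩
  obtain ⟨a, D, hD⟩ := exists_matrix_of_fg (hfg (LinearMap.ker ε))
  have hnext : ∀ X : (Σ b a : ℕ, Matrix (Fin b) (Fin a) Λ),
      ∃ Y : (Σ c : ℕ, Matrix (Fin X.2.1) (Fin c) Λ),
        Function.Exact (colMap Λ Y.2) (colMap Λ X.2.2) := by
    rintro ⟨b, a, D⟩
    obtain ⟨c, D', hD'⟩ := exists_matrix_of_fg (hfg (LinearMap.ker (colMapLinear D)))
    exact ⟨⟨c, D'⟩, hD'⟩
  choose next hn using hnext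
  let u : ℕ → (Σ b a : ℕ, Matrix (Fin b) (Fin a) Λ) := fun j =>
    Nat.rec ⟨n, a, D⟩ (fun _ X => ⟨X.2.1, (next X).1, (next X).2⟩) j
  let r : ℕ → ℕ
    | 0 => 0
    | j + 1 => (u j).1
  let d : ∀ j, Matrix (Fin (r j)) (Fin (r (j + 1))) Λ
    | 0 => Matrix.of fun i _ => i.elim0
    | j + 1 => (u j).2.2
  exact ⟨{
    r := r
    d := d
    ε := ε
    r_zero := rfl
    surjective := hε
    exact_zero := hD
    exact_succ := fun j => hn (u j) }⟩

end Resolution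

/-! ### Duality: maps out of Ext, and maps out of A. -/

section Duality

open Abelian Matrix

variable {Λ : Type u} [Ring Λ]

namespace MatrixResolution

variable {A : Type u} [AddCommGroup A] [Module Λᵐᵒᵖ A]

instance (P : MatrixResolution Λ A) : IsEmpty (Fin (P.r 0)) := by rw [P.r_zero]; infer_instance

lemma d_mul_d (P : MatrixResolution Λ A) (i : ℕ) : P.d i * P.d (i + 1) = 0 := by
  rcases i with _ | i
  · ext i; exact isEmptyElim i
  · exact mul_eq_zero_of_colMap_exact (P.exact_succ i)

lemma colExactFor (P : MatrixResolution Λ A) (k : ℕ) : ColExactFor Λ k (P.d (k + 1)) := by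
  induction k with
  | zero => trivial
  | succ k ih => exact ⟨_, P.d (k + 1), P.exact_succ k, ih⟩

/-- The dual complex is exact in the degrees in which `Ext` vanishes. -/
lemma exists_vecMul_eq (P : MatrixResolution Λ A) {k : ℕ}
    (h : Subsingleton (Ext (ModuleCat.of Λᵐᵒᵖ A) (ModuleCat.of Λᵐᵒᵖ Λ) k))
    {p : Fin (P.r (k + 1)) → Λ} (hp : p ᵥ* P.d (k + 1) = 0) : ∃ q, q ᵥ* P.d k = p := by
  obtain ⟨σ, -, hσ⟩ := P.exists_ext_presentation k
  exact (hσ ⟨p, hp⟩).1 (Subsingleton.elim _ _)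

lemma finite_ext [IsNoetherianRing Λ] (P : MatrixResolution Λ A) (k : ℕ) :
    Module.Finite Λ (Ext (ModuleCat.of Λᵐᵒᵖ A) (ModuleCat.of Λᵐᵒᵖ Λ) k) := by
  obtain ⟨σ, hσ, -⟩ := P.exists_ext_presentation k
  exact Module.Finite.of_surjective σ hσ

/-- If the complex stays exact at place `k` after tensoring with the injective left module `E`,
then `Hom(Extᵏ(A, Λ), E) = 0`. -/
lemma ext_linearMap_eq_zero (P : MatrixResolution Λ A) {E : Type u} [AddCommGroup E]
    [Module Λ E] [Module.Injective Λ E] {k : ℕ}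
    (hE : Function.Exact (colMap E (P.d (k + 1))) (colMap E (P.d k)))
    (φ : Ext (ModuleCat.of Λᵐᵒᵖ A) (ModuleCat.of Λᵐᵒᵖ Λ) k →ₗ[Λ] E) : φ = 0 := by
  obtain ⟨σ, hσ, hσ0⟩ := P.exists_ext_presentation k
  -- By injectivity the map extends from cocycles to all rows, where it is given by a column over E.
  obtain ⟨ψ, hψ⟩ := Module.Injective.out (LinearMap.ker (vecMulLinear (P.d (k + 1)))).subtype
    (Submodule.injective_subtype _) (φ ∘ₗ σ)
  have hψs : ∀ x, ψ x = ∑ j, x j • ψ (Pi.single j 1) := fun x => by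
    simp only [← map_smul, ← map_sum]
    congr 1
    ext i
    simp [Finset.sum_apply, Pi.single_apply]
  -- The rows of `P.d k` are coboundaries, so `P.d k` kills this column; exactness writes it as `P.d
  -- (k + 1)` applied to f, which pairs to zero with every cocycle.
  obtain ⟨f, hf⟩ := (hE fun j => ψ (Pi.single j 1)).1 (by
    ext i
    have hmem : (P.d k i) ∈ LinearMap.ker (vecMulLinear (P.d (k + 1))) := by
      have h := congrFun (P.d_mul_d k) i
      rwa [Matrix.mul_apply_eq_vecMul] at h
    have h0 : σ ⟨P.d k i, hmem⟩ = 0 := (hσ0 _).2 ⟨Pi.single i 1, by simp; rfl⟩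
    have h1 := hψ ⟨P.d k i, hmem⟩
    rw [LinearMap.comp_apply, h0, map_zero] at h1
    rw [colMap_apply, ← hψs]
    exact h1)
  ext y
  obtain ⟨p, rfl⟩ := hσ y
  refine (hψ p).symm.trans ?_
  rw [hψs]
  have hp : p.1 ᵥ* P.d (k + 1) = 0 := p.2
  have h2 : ∀ j, ψ (Pi.single j 1) = ∑ i, P.d (k + 1) j i • f i := fun j => (congrFun hf j).symm
  simp only [h2, Finset.smul_sum, ← mul_smul]
  rw [Finset.sum_comm]
  refine Finset.sum_eq_zero fun i _ => ?_
  rw [← Finset.sum_smul]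
  have h3 : ∑ j, p.1 j * P.d (k + 1) j i = 0 := congrFun hp i
  exact (congrArg (· • f i) h3).trans (zero_smul _ _)

/-- The transpose of a matrix, over the opposite ring. -/
abbrev opTranspose {m n : Type*} (D : Matrix m n Λ) : Matrix n m Λᵐᵒᵖ :=
  D.transpose.map MulOpposite.op

/-- Identifies the dual complex, acting on rows over Λ, with a sequence of matrices over `Λᵐᵒᵖ`, to
which the results on columns apply for right modules. -/
lemma colMap_opTranspose {m n : Type*} [Fintype m] (D : Matrix m n Λ) (q : m → Λᵐᵒᵖ) (j : n) :
    colMap Λᵐᵒᵖ (opTranspose D) q j =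
      MulOpposite.op (((fun i => (q i).unop) ᵥ* D) j) := by
  simp [colMap_apply, vecMul, dotProduct]

lemma exact_opTranspose (P : MatrixResolution Λ A) {k : ℕ}
    (h : Subsingleton (Ext (ModuleCat.of Λᵐᵒᵖ A) (ModuleCat.of Λᵐᵒᵖ Λ) k)) :
    Function.Exact (colMap Λᵐᵒᵖ (opTranspose (P.d k)))
      (colMap Λᵐᵒᵖ (opTranspose (P.d (k + 1)))) := by
  intro p
  constructor
  · intro hp
    obtain ⟨q, hq⟩ := P.exists_vecMul_eq h (p := fun i => (p i).unop) (by
      ext j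
      have := congrFun hp j
      rw [colMap_opTranspose] at this
      exact MulOpposite.op_injective this)
    refine ⟨fun i => MulOpposite.op (q i), ?_⟩
    ext j
    rw [colMap_opTranspose]
    simp [hq]
  · rintro ⟨q, rfl⟩
    ext j
    rw [colMap_opTranspose]
    simp only [colMap_opTranspose, MulOpposite.unop_op]
    rw [vecMul_vecMul, P.d_mul_d, vecMul_zero]; rfl

lemma colExactFor_opTranspose (P : MatrixResolution Λ A) (n : ℕ) : ∀ p : ℕ,
    (∀ i, p ≤ i → i < p + n →
      Subsingleton (Ext (ModuleCat.of Λᵐᵒᵖ A) (ModuleCat.of Λᵐᵒᵖ Λ) i)) →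
    ColExactFor Λᵐᵒᵖ n (opTranspose (P.d p)) := by
  induction n with
  | zero => intros; trivial
  | succ n ih =>
    intro p h
    exact ⟨_, opTranspose (P.d (p + 1)), P.exact_opTranspose (h p le_rfl (by omega)),
      ih (p + 1) fun i h1 h2 => h i (by omega) (by omega)⟩

/-- A map A → E is a column over E of length `P.r 1` killed by the transpose of `P.d 1`. The dual
complex is exact at enough places for exactness to persist over E, so this column comes from E^{r 0}
= 0. -/
lemma linearMap_eq_zero_of_rightFlatDimLT (P : MatrixResolution Λ A) {E : Type u}
    [AddCommGroup E] [Module Λᵐᵒᵖ E] {k : ℕ}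
    (hE : RightFlatDimLT Λ E k)
    (h : ∀ i < k, Subsingleton (Ext (ModuleCat.of Λᵐᵒᵖ A) (ModuleCat.of Λᵐᵒᵖ Λ) i))
    (φ : A →ₗ[Λᵐᵒᵖ] E) : φ = 0 := by
  rcases k with _ | n
  · have : Subsingleton E := hE
    exact Subsingleton.elim _ _
  · obtain ⟨f, hf⟩ := (colMap_exact_of_hasResolutionLT
      (fun F hF => RightFlat.preservesColExact Λ hF) hE _ _
      (P.exact_opTranspose (h 0 n.succ_pos))
      (P.colExactFor_opTranspose n 1 fun i _ hi => h i (by omega))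
      fun j => φ (P.ε (Pi.single j 1))).1 (by
        ext c
        have h1 := linearMap_eq_sum (φ ∘ₗ P.ε) (colMap Λ (P.d 1) (Pi.single c 1))
        rw [LinearMap.comp_apply, P.exact_zero.apply_apply_eq_zero, map_zero] at h1
        refine Eq.trans ?_ h1.symm
        simp [colMap_apply, Pi.single_apply])
    have h0 : ∀ j, φ (P.ε (Pi.single j 1)) = 0 := fun j => by
      refine (congrFun hf j).symm.trans ?_
      simp [colMap_apply]
    ext y
    obtain ⟨x, rfl⟩ := P.surjective y
    rw [← LinearMap.comp_apply, linearMap_eq_sum]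
    simp [h0]

end MatrixResolution

lemma ext_pi_eq_zero {T : ModuleCat.{u} Λ} {m : ℕ}
    (h : Subsingleton (Ext T (ModuleCat.of Λ Λ) m)) {n : ℕ}
    (x : Ext T (ModuleCat.of Λ (Fin n → Λ)) m) : x = 0 := by
  have hid : 𝟙 (ModuleCat.of Λ (Fin n → Λ)) = ∑ j : Fin n,
      (ModuleCat.ofHom (LinearMap.proj j) : _ ⟶ ModuleCat.of Λ Λ) ≫
        ModuleCat.ofHom (LinearMap.single Λ (fun _ => Λ) j) := by
    ext : 1
    rw [ModuleCat.hom_sum]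
    refine LinearMap.ext fun x => ?_
    ext i
    simp [Finset.sum_apply, Pi.single_apply]
  rw [← Ext.comp_mk₀_id x, hid, Ext.mk₀_sum, Ext.comp_sum]
  refine Finset.sum_eq_zero fun j _ => ?_
  rw [← Ext.mk₀_comp_mk₀, ← Ext.comp_assoc_of_third_deg_zero, Subsingleton.elim (x.comp _ _) 0,
    Ext.zero_comp]

lemma shortExact_subtype_mkQ {S : Type u} [Ring S] {M : Type u} [AddCommGroup M] [Module S M]
    {L : Type u} [AddCommGroup L] [Module S L] (U : Submodule S M) (g : M →ₗ[S] L)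
    (hg : Function.Surjective g) (hU : LinearMap.ker g = U) :
    (ShortComplex.mk (ModuleCat.ofHom U.subtype) (ModuleCat.ofHom g)
      (by ext x; exact hU.ge x.2)).ShortExact := by
  refine ModuleCat.shortComplex_shortExact _ ?_ U.injective_subtype hg
  intro x
  refine (SetLike.ext_iff.1 hU x).trans ?_
  exact ⟨fun h => ⟨⟨x, h⟩, rfl⟩, by rintro ⟨y, rfl⟩; exact y.2⟩

namespace MatrixResolution

variable {A : Type u} [AddCommGroup A] [Module Λᵐᵒᵖ A]

/-- Let W_j be the row space of `P.d j`. Vanishing of Ext^j(A,Λ) makes 0 → W_j → Λ^{r(j+1)} →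
W_{j+1} → 0 exact, and W_0 = 0. Each step trades one degree of Ext for one index, so the sum m + j
is what is bounded. -/
lemma ext_range_eq_zero (P : MatrixResolution Λ A) {k : ℕ}
    (h : ∀ i < k, Subsingleton (Ext (ModuleCat.of Λᵐᵒᵖ A) (ModuleCat.of Λᵐᵒᵖ Λ) i))
    {T : ModuleCat.{u} Λ} (hT : ∀ m ≤ k, Subsingleton (Ext T (ModuleCat.of Λ Λ) m)) (j : ℕ) :
    ∀ m, m + j ≤ k + 1 → j ≤ k →
      ∀ x : Ext T (ModuleCat.of Λ (LinearMap.range (vecMulLinear (P.d j)))) m, x = 0 := by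
  induction j with
  | zero =>
    intro m _ _ x
    have hz : 𝟙 (ModuleCat.of Λ (LinearMap.range (vecMulLinear (P.d 0)))) = 0 := by
      ext ⟨_, q, rfl⟩
      rw [Subsingleton.elim q 0]
      simp
    rw [← Ext.comp_mk₀_id x, hz, Ext.mk₀_zero, Ext.comp_zero]
  | succ j ih =>
    intro m hm hj x
    have hS := shortExact_subtype_mkQ (LinearMap.range (vecMulLinear (P.d j)))
      (vecMulLinear (P.d (j + 1))).rangeRestrict (LinearMap.surjective_rangeRestrict _) (by
        ext p
        rw [LinearMap.ker_rangeRestrict]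
        constructor
        · exact fun hp => P.exists_vecMul_eq (h j (by omega)) hp
        · rintro ⟨q, rfl⟩
          simp [P.d_mul_d])
    obtain ⟨y, rfl⟩ := Ext.covariant_sequence_exact₃ T hS x rfl
      (ih (m + 1) (by omega) (by omega) _)
    rw [ext_pi_eq_zero (hT m (by omega)) y, Ext.zero_comp]

/-- If `Extⁱ(A, Λ) = 0` for `i < k`, then `T = Extᵏ(A, Λ)` embeds in a left module of projective
dimension at most `k`; hence `T = 0` if `Extᵐ(T, Λ) = 0` for all `m ≤ k`. -/
lemma subsingleton_ext_of_forall_ext_ext (P : MatrixResolution Λ A) {k : ℕ}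
    (h : ∀ i < k, Subsingleton (Ext (ModuleCat.of Λᵐᵒᵖ A) (ModuleCat.of Λᵐᵒᵖ Λ) i))
    (hT : ∀ m ≤ k, Subsingleton (Ext (ModuleCat.of Λ
      (Ext (ModuleCat.of Λᵐᵒᵖ A) (ModuleCat.of Λᵐᵒᵖ Λ) k)) (ModuleCat.of Λ Λ) m)) :
    Subsingleton (Ext (ModuleCat.of Λᵐᵒᵖ A) (ModuleCat.of Λᵐᵒᵖ Λ) k) := by
  obtain ⟨σ, hσ, hσ0⟩ := P.exists_ext_presentation k
  let W := LinearMap.range (vecMulLinear (P.d k))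
  -- Cocycles modulo coboundaries sit inside all rows modulo coboundaries; `f` is this embedding of
  -- Ext^k.
  let θ := W.mkQ ∘ₗ (LinearMap.ker (vecMulLinear (P.d (k + 1)))).subtype
  have hθ : ∀ p, θ p = 0 ↔ σ p = 0 := fun p => by
    rw [hσ0]
    exact Submodule.Quotient.mk_eq_zero W
  let e := σ.quotKerEquivOfSurjective hσ
  have hle : LinearMap.ker σ ≤ LinearMap.ker θ := fun p hp => (hθ p).2 hp
  let f := (LinearMap.ker σ).liftQ θ hle ∘ₗ e.symm.toLinearMap
  have hf : ∀ p, f (σ p) = θ p := fun p => by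
    have : e.symm (σ p) = Submodule.Quotient.mk p := by
      rw [LinearEquiv.symm_apply_eq]; rfl
    change (LinearMap.ker σ).liftQ θ hle (e.symm (σ p)) = θ p
    rw [this]
    rfl
  have hS := shortExact_subtype_mkQ W W.mkQ W.mkQ_surjective W.ker_mkQ
  -- Ext¹(T,W) = 0 lifts `f` to a map from T to a free module, which is zero because Hom(T,Λ) = 0.
  obtain ⟨y, hy⟩ := Ext.covariant_sequence_exact₃ (ModuleCat.of Λ _) hS
    (Ext.mk₀ (ModuleCat.ofHom f)) rfl (P.ext_range_eq_zero h hT k _ (by omega) le_rfl _)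
  rw [ext_pi_eq_zero (hT 0 (Nat.zero_le k)) y, Ext.zero_comp] at hy
  have hf0 := (Ext.mk₀_eq_zero_iff _).1 hy.symm
  refine subsingleton_of_forall_eq 0 fun t => ?_
  obtain ⟨p, rfl⟩ := hσ t
  rw [← hθ, ← hf]
  exact congrArg (fun g => g.hom (σ p)) hf0

end MatrixResolution

end Duality

/-! ### The two implications. -/

section Pure

open Abelian

variable {Λ : Type u} [Ring Λ] [IsNoetherianRing Λᵐᵒᵖ]

/-- If `l.fd (⨁ I'ᵢ) ≤ k`, then no submodule of `Extᵏ⁺¹(B, Λ)` has a nonzero map to any `I'ᵢ`. -/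
lemma linearMap_eq_zero_of_leftFlatDimLE {ι : Type} [DecidableEq ι] {E : ι → Type u}
    [∀ i, AddCommGroup (E i)] [∀ i, Module Λ (E i)] [∀ i, Module.Injective Λ (E i)] {k : ℕ}
    (hE : LeftFlatDimLE Λ (⨁ i, E i) k) {B : Type u} [AddCommGroup B] [Module Λᵐᵒᵖ B]
    [Module.Finite Λᵐᵒᵖ B] {T : Type u} [AddCommGroup T] [Module Λ T]
    (δ : T →ₗ[Λ] Ext (ModuleCat.of Λᵐᵒᵖ B) (ModuleCat.of Λᵐᵒᵖ Λ) (k + 1))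
    (hδ : Function.Injective δ) (i : ι) (φ : T →ₗ[Λ] E i) : φ = 0 := by
  obtain ⟨P⟩ := exists_matrixResolution (Λ := Λ) B
  -- This is Tor_{k+1}(B, E i) = 0, inherited from the direct sum by its summand.
  have hexact : Function.Exact (colMap (E i) (P.d (k + 2))) (colMap (E i) (P.d (k + 1))) :=
    colMap_exact_of_retract (DirectSum.lof Λ ι E i) (DirectSum.component Λ ι E i)
      (fun x => DirectSum.component.lof_self Λ i x)
      (colMap_exact_of_hasResolutionLT (fun F hF => LeftFlat.preservesColExact Λ hF) hE _ _
        (P.exact_succ k) (P.colExactFor k))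
  obtain ⟨ψ, hψ⟩ := Module.Injective.out δ hδ φ
  ext t
  rw [← hψ, P.ext_linearMap_eq_zero hexact ψ]
  rfl

theorem IsPureOfGrade.embedsInFiniteCopies [IsNoetherianRing Λ]
    (I : InjectiveResolution (ModuleCat.of Λᵐᵒᵖ Λ)) (I' : InjectiveResolution (ModuleCat.of Λ Λ))
    {k : ℕ} {N : Type u} [AddCommGroup N] [Module Λᵐᵒᵖ N] [Module.Finite Λᵐᵒᵖ N]
    (hfd : LeftFlatDimLE Λ (⨁ i : Fin (k + 1), (I'.cocomplex.X i : Type u)) k)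
    (hN : IsPureOfGrade Λ N k) : EmbedsInFiniteCopies Λᵐᵒᵖ N (I.cocomplex.X k) := by
  obtain ⟨PN⟩ := exists_matrixResolution (Λ := Λ) N
  have hfin := PN.finite_ext k
  obtain ⟨n, e, he⟩ := Module.Finite.exists_fin (R := Λ)
    (M := Ext (ModuleCat.of Λᵐᵒᵖ N) (ModuleCat.of Λᵐᵒᵖ Λ) k)
  choose g hg using fun i => exists_hom_of_ext I (e i)
  let f : N →ₗ[Λᵐᵒᵖ] (Fin n → I.cocomplex.X k) := LinearMap.pi fun i => (g i).hom
  refine ⟨n, f, LinearMap.ker_eq_bot.1 ?_⟩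
  by_contra hA
  obtain ⟨hlt, hnt⟩ := hN.2 (LinearMap.ker f) hA
  -- Restriction to the common kernel is left linear and kills the generators `e i`.
  have hres : extPrecomp (Ext.mk₀ (ModuleCat.ofHom (LinearMap.ker f).subtype)) (zero_add k) =
      (0 : Ext (ModuleCat.of Λᵐᵒᵖ N) (ModuleCat.of Λᵐᵒᵖ Λ) k →ₗ[Λ] _) := by
    refine LinearMap.ext_on he ?_
    rintro _ ⟨i, rfl⟩
    refine hg i _ ?_
    ext x
    exact congrFun x.2 i
  have hS := shortExact_subtype_mkQ (LinearMap.ker f) (LinearMap.ker f).mkQ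
    (Submodule.mkQ_surjective _) (Submodule.ker_mkQ _)
  let δ := extPrecomp (Λ := Λ) hS.extClass (add_comm 1 k)
  -- In the long exact sequence, the kernel of the connecting map is the image of the zero
  -- restriction.
  have hδ : Function.Injective δ := by
    rw [injective_iff_map_eq_zero]
    intro t ht
    obtain ⟨y, rfl⟩ := Ext.contravariant_sequence_exact₁ hS _ t (add_comm 1 k) ht
    exact LinearMap.congr_fun hres y
  have hinj : ∀ i : Fin (k + 1), Module.Injective Λ (I'.cocomplex.X i) := fun i =>
    @Module.injective_module_of_injective_object Λ (I'.cocomplex.X i) _ _ _ (I'.injective i)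
  obtain ⟨PA⟩ := exists_matrixResolution (Λ := Λ) (LinearMap.ker f)
  have := PA.subsingleton_ext_of_forall_ext_ext hlt fun m hm =>
    subsingleton_of_forall_eq 0 (ext_eq_zero_of_forall_hom I' fun φ => by
      ext1
      exact linearMap_eq_zero_of_leftFlatDimLE hfd δ hδ (⟨m, by omega⟩ : Fin (k + 1)) φ.hom)
  exact not_subsingleton _ this

theorem HasGrade.isPureOfGrade (I : InjectiveResolution (ModuleCat.of Λᵐᵒᵖ Λ)) {k : ℕ} {N : Type u}
    [AddCommGroup N] [Module Λᵐᵒᵖ N] [Module.Finite Λᵐᵒᵖ N] (hN : HasGrade Λ N k)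
    (hfd : RightFlatDimLT Λ (⨁ i : Fin k, (I.cocomplex.X i : Type u)) k)
    (hfdk : RightFlatDimLE Λ (I.cocomplex.X k) k)
    (hemb : EmbedsInFiniteCopies Λᵐᵒᵖ N (I.cocomplex.X k)) : IsPureOfGrade Λ N k := by
  refine ⟨?_, fun A hA => ?_⟩
  · by_contra h
    rw [not_nontrivial_iff_subsingleton] at h
    have hid : 𝟙 (ModuleCat.of Λᵐᵒᵖ N) = 0 := by
      ext x
      exact Subsingleton.elim (α := N) _ _
    have := hN.2
    refine not_subsingleton (Ext (ModuleCat.of Λᵐᵒᵖ N) (ModuleCat.of Λᵐᵒᵖ Λ) k)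
      (subsingleton_of_forall_eq 0 fun x => ?_)
    rw [← Ext.mk₀_id_comp x, hid, Ext.mk₀_zero, Ext.zero_comp]
  · obtain ⟨PN⟩ := exists_matrixResolution (Λ := Λ) N
    obtain ⟨PA⟩ := exists_matrixResolution (Λ := Λ) A
    have hlt : ∀ i < k, Subsingleton (Ext (ModuleCat.of Λᵐᵒᵖ A) (ModuleCat.of Λᵐᵒᵖ Λ) i) := by
      intro i hi
      refine subsingleton_of_forall_eq 0 (ext_eq_zero_of_forall_hom I fun φ => ?_)
      have hinj : Module.Injective Λᵐᵒᵖ (I.cocomplex.X i) :=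
        @Module.injective_module_of_injective_object Λᵐᵒᵖ (I.cocomplex.X i) _ _ _ (I.injective i)
      -- A map A → I_i extends to N by injectivity, and N has no nonzero map to the direct sum of
      -- the I_i with i < k.
      obtain ⟨ψ, hψ⟩ := Module.Injective.out A.subtype A.injective_subtype φ.hom
      have h0 := PN.linearMap_eq_zero_of_rightFlatDimLT hfd hN.1
        (DirectSum.lof Λᵐᵒᵖ (Fin k) (fun i => (I.cocomplex.X i : Type u)) ⟨i, hi⟩ ∘ₗ ψ)
      ext x
      refine (hψ x).symm.trans ?_
      rw [← DirectSum.component.lof_self Λᵐᵒᵖ (M := fun i : Fin k => (I.cocomplex.X i : Type u))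
        ⟨i, hi⟩ (ψ (A.subtype x))]
      exact (congrArg (DirectSum.component Λᵐᵒᵖ _ _ _) (LinearMap.congr_fun h0 (A.subtype x))).trans
        (map_zero _)
    refine ⟨hlt, ?_⟩
    by_contra h
    rw [not_nontrivial_iff_subsingleton] at h
    obtain ⟨n, f, hf⟩ := hemb
    -- With Ext^i(A,Λ) = 0 for all i ≤ k, the bound r.fd I_k ≤ k kills every component of the
    -- embedding on A.
    have h0 : ∀ j, LinearMap.proj j ∘ₗ f ∘ₗ A.subtype = 0 := fun j =>
      PA.linearMap_eq_zero_of_rightFlatDimLT hfdk (fun i hi => by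
        rcases (Nat.lt_succ_iff_lt_or_eq.1 hi) with hi | rfl
        exacts [hlt i hi, h]) _
    refine hA ((Submodule.eq_bot_iff A).2 fun x hx => hf ?_)
    rw [map_zero]
    ext j
    exact LinearMap.congr_fun (h0 j) ⟨x, hx⟩

end Pure

end PureModules

theorem theorem3p6 (Λ : Type u) [Ring Λ] [IsNoetherianRing Λ] [IsNoetherianRing Λᵐᵒᵖ]
    (I : InjectiveResolution (ModuleCat.of Λᵐᵒᵖ Λ)) (hI : PureModules.IsMinimal I)
    (I' : InjectiveResolution (ModuleCat.of Λ Λ)) (hI' : PureModules.IsMinimal I')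
    (k : ℕ) (N : Type u) [AddCommGroup N] [Module Λᵐᵒᵖ N] [Module.Finite Λᵐᵒᵖ N]
    (hN : PureModules.HasGrade Λ N k) :
    (PureModules.LeftFlatDimLE Λ (⨁ i : Fin (k + 1), (I'.cocomplex.X i : Type u)) k →
      PureModules.IsPureOfGrade Λ N k →
        PureModules.EmbedsInFiniteCopies Λᵐᵒᵖ N (I.cocomplex.X k)) ∧
    (PureModules.RightFlatDimLT Λ (⨁ i : Fin k, (I.cocomplex.X i : Type u)) k →
      PureModules.RightFlatDimLE Λ (I.cocomplex.X k) k →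
      PureModules.EmbedsInFiniteCopies Λᵐᵒᵖ N (I.cocomplex.X k) →
        PureModules.IsPureOfGrade Λ N k) := by
  exact ⟨fun hfd h => h.embedsInFiniteCopies I I' hfd, hN.isPureOfGrade I⟩
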